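/- Let $S\subset\mathbb R$ be a countable dense set. Let $\mathcal F$ be the class of finite metric spaces $X$ all of whose distances between distinct points lie in $S$ and which embed isometrically into the unit sphere of $\mathbb R^n$, for some $n$, in such a way that the origin together with the points of $X$ is affinely independent. View the members of $\mathcal F$ as structures in the relational language with one binary relation symbol $R_s$ for each $s\in S$, where $R_s(x,y)$ means $d(x,y)=s$, so that embeddings of structures are isometric embeddings. Let $M$ be the Fraïssé limit of $\mathcal F$, i.e. the countable ultrahomogeneous structure whose finite substructures are, up to isomorphism, exactly the members of $\mathcal F$, and let $G=\mathrm{Aut}(M)$ with the topology of pointwise convergence ($M$ being discrete). Then $M$ weakly eliminates imaginaries: for every proper open subgroup $V<G$ there are $k\in\mathbb N$ and a tuple $\bar a\in M^k$ such that the pointwise stabilizer $G_{\bar a}$ satisfies $G_{\bar a}\le V$ and $[V:G_{\bar a}]<\infty$. -/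

import Mathlib

open scoped FirstOrder

universe u v w

/-! ### The group of automorphisms of a first-order structure -/

section Aut

variable {L : FirstOrder.Language.{u, v}} {M : Type w} [L.Structure M]

/-- The automorphisms of a structure form a group under composition. -/
instance autGroup : Group (M ≃[L] M) where
  mul g h := g.comp h
  one := FirstOrder.Language.Equiv.refl L M
  inv g := g.symm
  mul_assoc _ _ _ := rfl
  one_mul _ := rfl
  mul_one _ := rfl
  inv_mul_cancel g := g.symm_comp_self

/-- The automorphism group acts on the structure by evaluation. -/
instance autMulAction : MulAction (M ≃[L] M) M where
  smul g x := g x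
  one_smul _ := rfl
  mul_smul _ _ _ := rfl

/-- The topology of pointwise convergence on the automorphism group, the underlying set of the
structure being discrete. -/
instance autTopology : TopologicalSpace (M ≃[L] M) :=
  TopologicalSpace.induced (fun (g : M ≃[L] M) (x : M) => g x)
    (@Pi.topologicalSpace M (fun _ => M) (fun _ => ⊥))

end Aut

/-- The pointwise stabilizer `G_a` of a finite tuple `a` in the automorphism group `G`. -/
def tupleStabilizer (L : FirstOrder.Language.{u, v}) {M : Type w} [L.Structure M] {k : ℕ} (a : Fin k → M) :
    Subgroup (M ≃[L] M) :=
  fixingSubgroup (M ≃[L] M) (Set.range a)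

/-- Weak elimination of imaginaries: every proper open subgroup `V` of the automorphism group `G`
contains, with finite index, the pointwise stabilizer of some finite tuple. -/
def WeaklyEliminatesImaginaries (L : FirstOrder.Language.{u, v}) (M : Type w) [L.Structure M] : Prop :=
  ∀ V : Subgroup (M ≃[L] M), V ≠ ⊤ → IsOpen (V : Set (M ≃[L] M)) →
    ∃ (k : ℕ) (a : Fin k → M),
      tupleStabilizer L a ≤ V ∧ (tupleStabilizer L a).IsFiniteRelIndex V

/-! ### The class of finite affinely independent spherical `S`-metric spaces -/

/-- One binary relation symbol for each distance in `S`. -/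
inductive DistRel (S : Set ℝ) : ℕ → Type
  | dist (s : S) : DistRel S 2

/-- The relational language of `S`-metric spaces. -/
def metricLanguage (S : Set ℝ) : FirstOrder.Language.{0, 0} := ⟨fun _ => Empty, DistRel S⟩

instance metricLanguage.isRelational (S : Set ℝ) : (metricLanguage S).IsRelational :=
  fun _ => inferInstanceAs (IsEmpty Empty)

/-- The symbol `d(x, y) = s`. -/
def distSymbol {S : Set ℝ} (s : S) : (metricLanguage S).Relations 2 := DistRel.dist s

/-- The class of finite `S`-metric spaces `X` that embed isometrically into the unit sphere of some
`ℝⁿ` in such a way that the origin together with the points of `X` is affinely independent.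
The relation symbol attached to `s` holds of `(x, y)` exactly when the distance of `x` and `y`
is `s`. -/
def sphericalClass (S : Set ℝ) :
    Set (CategoryTheory.Bundled.{w} (metricLanguage S).Structure) :=
  {X | Finite X ∧ ∃ (n : ℕ) (f : X → EuclideanSpace ℝ (Fin n)),
    (∀ x, f x ∈ Metric.sphere (0 : EuclideanSpace ℝ (Fin n)) 1) ∧
    AffineIndependent ℝ (fun o : Option X => o.elim (0 : EuclideanSpace ℝ (Fin n)) f) ∧
    (∀ x y, x ≠ y → dist (f x) (f y) ∈ S) ∧
    ∀ (s : S) (x y : X),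
      FirstOrder.Language.Structure.RelMap (distSymbol s) ![x, y] ↔ dist (f x) (f y) = s}

/-! ### Permutation groups: from one-point amalgams of stabilizers to weak elimination of
imaginaries -/

section PermutationGroups

variable {G : Type*} {α : Type*} [Group G] [MulAction G α]

/-! Write `G_C` for the pointwise stabilizer of a finite set `C`. Everything rests on one-point
generation: `G_C` is generated by `G_{Ca}` and `G_{Cb}` for distinct `a`, `b` outside `C`. By
induction, `G_{A∩B} ≤ ⟨G_A, G_B⟩` for all finite `A`, `B`. An open `V` contains some `G_A`; for a
minimal such `A`, intersecting `A` with its `V`-translates shows that `V` preserves `A`, so `G_A`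
has finite index in `V`.

One-point generation is geometric. Realize `M` as linearly independent unit vectors, so that types
over `C` are given by inner products. If `a'` has the type of `a` over `C` and is close to `a`, some
`b'` of the type of `b` over `C` relates to both `a` and `a'` as `b` does to `a`
(`exists_common_point`); then `⟨G_{Ca}, G_{Cb}⟩` moves `a` to `a'`. Approximate midpoints, found by
density of `S` (`exists_midpoint`), reduce distant `a'` to close ones. Thus the subgroup is
transitive on the `G_C`-orbit of `a` and contains `G_{Ca}`, so it is all of `G_C`. -/

theorem fixingSubgroup_le_sup_insert [DecidableEq α]
    (h : ∀ (C : Finset α) (a b : α), a ∉ C → b ∉ C → a ≠ b →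
      fixingSubgroup G (C : Set α) ≤
        fixingSubgroup G ((insert a C : Finset α) : Set α) ⊔
          fixingSubgroup G ((insert b C : Finset α) : Set α))
    (C D : Finset α) (a : α) (ha : a ∉ D) :
    fixingSubgroup G (C : Set α) ≤
      fixingSubgroup G ((insert a C : Finset α) : Set α) ⊔
        fixingSubgroup G ((C ∪ D : Finset α) : Set α) := by
  by_cases haC : a ∈ C
  · rw [Finset.insert_eq_of_mem haC]
    exact le_sup_left
  induction D using Finset.induction_on with
  | empty => rw [Finset.union_empty]; exact le_sup_right
  | insert d D hd ih =>
    rw [Finset.mem_insert, not_or] at ha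
    refine (ih ha.2).trans (sup_le le_sup_left ?_)
    rw [Finset.union_insert]
    by_cases hdCD : d ∈ C ∪ D
    · rw [Finset.insert_eq_of_mem hdCD]
      exact le_sup_right
    -- Split the stabilizer of `C ∪ D` by the pair `a`, `d`; the part fixing `a` already lies in the
    -- stabilizer of `insert a C`.
    refine (h (C ∪ D) a d (by simp [haC, ha.2]) hdCD ha.1).trans (sup_le_sup_right ?_ _)
    apply fixingSubgroup_antitone
    exact_mod_cast Finset.insert_subset_insert a Finset.subset_union_left

theorem fixingSubgroup_le_sup_union [DecidableEq α]
    (h : ∀ (C : Finset α) (a b : α), a ∉ C → b ∉ C → a ≠ b →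
      fixingSubgroup G (C : Set α) ≤
        fixingSubgroup G ((insert a C : Finset α) : Set α) ⊔
          fixingSubgroup G ((insert b C : Finset α) : Set α))
    (C D D' : Finset α) (hD : Disjoint D D') :
    fixingSubgroup G (C : Set α) ≤
      fixingSubgroup G ((C ∪ D : Finset α) : Set α) ⊔
        fixingSubgroup G ((C ∪ D' : Finset α) : Set α) := by
  induction D using Finset.induction_on with
  | empty => rw [Finset.union_empty]; exact le_sup_left
  | insert a D ha ih =>
    rw [Finset.disjoint_insert_left] at hD
    refine (ih hD.2).trans (sup_le ?_ le_sup_right)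
    rw [Finset.union_insert]
    refine (fixingSubgroup_le_sup_insert h (C ∪ D) D' a hD.1).trans (sup_le_sup_left ?_ _)
    apply fixingSubgroup_antitone
    exact_mod_cast Finset.union_subset_union_left Finset.subset_union_left

theorem fixingSubgroup_inter_le_sup [DecidableEq α]
    (h : ∀ (C : Finset α) (a b : α), a ∉ C → b ∉ C → a ≠ b →
      fixingSubgroup G (C : Set α) ≤
        fixingSubgroup G ((insert a C : Finset α) : Set α) ⊔
          fixingSubgroup G ((insert b C : Finset α) : Set α))
    (A B : Finset α) :
    fixingSubgroup G ((A ∩ B : Finset α) : Set α) ≤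
      fixingSubgroup G (A : Set α) ⊔ fixingSubgroup G (B : Set α) := by
  have key := fixingSubgroup_le_sup_union h (A ∩ B) (A \ B) (B \ A)
    (Finset.disjoint_left.2 fun x hx hx' => by simp_all)
  rwa [show A ∩ B ∪ A \ B = A by grind, show A ∩ B ∪ B \ A = B by grind] at key

/-- The stabilizer of `A` is a finite intersection of point stabilizers, and each point of `A` has
its `V`-orbit inside the finite set `A`. -/
theorem isFiniteRelIndex_fixingSubgroup (V : Subgroup G) (A : Finset α)
    (hV : ∀ g ∈ V, ∀ a ∈ A, g • a ∈ A) : (fixingSubgroup G (A : Set α)).IsFiniteRelIndex V := by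
  refine ⟨?_⟩
  have h : fixingSubgroup G (A : Set α) = ⨅ a : A, MulAction.stabilizer G (a : α) := by
    ext g
    simp [mem_fixingSubgroup_iff, Subgroup.mem_iInf]
  rw [h]
  refine Subgroup.relIndex_iInf_ne_zero fun a => ?_
  have h' : (MulAction.stabilizer G (a : α)).subgroupOf V = MulAction.stabilizer V (a : α) := rfl
  rw [Subgroup.relIndex, h', MulAction.index_stabilizer]
  have hsub : MulAction.orbit V (a : α) ⊆ A := by
    rintro _ ⟨g, rfl⟩
    exact hV g g.2 a a.2
  exact Set.ncard_ne_zero_of_mem (MulAction.mem_orbit_self _) (A.finite_toSet.subset hsub)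

theorem exists_fixingSubgroup_le_isFiniteRelIndex [DecidableEq α]
    (h : ∀ (C : Finset α) (a b : α), a ∉ C → b ∉ C → a ≠ b →
      fixingSubgroup G (C : Set α) ≤
        fixingSubgroup G ((insert a C : Finset α) : Set α) ⊔
          fixingSubgroup G ((insert b C : Finset α) : Set α))
    (V : Subgroup G) (A₀ : Finset α) (hA₀ : fixingSubgroup G (A₀ : Set α) ≤ V) :
    ∃ A : Finset α, fixingSubgroup G (A : Set α) ≤ V ∧
      (fixingSubgroup G (A : Set α)).IsFiniteRelIndex V := by
  obtain ⟨A, hA, hmin⟩ := exists_minimal_of_wellFoundedLT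
    (fun A : Finset α => fixingSubgroup G (A : Set α) ≤ V) ⟨A₀, hA₀⟩
  refine ⟨A, hA, isFiniteRelIndex_fixingSubgroup V A fun g hg a ha => ?_⟩
  -- The stabilizer of a translate of `A` is a conjugate, by an element of `V`, of the stabilizer of
  -- `A`.
  have hgA : fixingSubgroup G ((A.image (g⁻¹ • ·) : Finset α) : Set α) ≤ V := by
    intro k hk
    have hk' : g * k * g⁻¹ ∈ V := hA <| by
      rw [mem_fixingSubgroup_iff] at hk ⊢
      intro y hy
      have := hk (g⁻¹ • y) (by simpa using Finset.mem_coe.1 hy)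
      rw [mul_smul, mul_smul, this, smul_inv_smul]
    have := V.mul_mem (V.mul_mem (V.inv_mem hg) hk') hg
    simpa [mul_assoc] using this
  have hle := hmin ((fixingSubgroup_inter_le_sup h A _).trans (sup_le hA hgA))
    Finset.inter_subset_left
  have := Finset.mem_of_mem_inter_right (hle ha)
  obtain ⟨b, hb, hba⟩ := Finset.mem_image.1 this
  rw [← hba]
  simpa using hb

end PermutationGroups

/-! ### Open subgroups of the automorphism group -/

theorem exists_fixingSubgroup_le_of_isOpen {L : FirstOrder.Language.{u, v}} {M : Type w}
    [L.Structure M] (V : Subgroup (M ≃[L] M)) (hV : IsOpen (V : Set (M ≃[L] M))) :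
    ∃ A : Finset M, fixingSubgroup (M ≃[L] M) (A : Set M) ≤ V := by
  let : TopologicalSpace M := ⊥
  obtain ⟨U, hU, hUV⟩ := isOpen_induced_iff.1 hV
  obtain ⟨A, u, hu, hAu⟩ := isOpen_pi_iff.1 hU (fun x => (1 : M ≃[L] M) x)
    (show (1 : M ≃[L] M) ∈ (fun (g : M ≃[L] M) (x : M) => g x) ⁻¹' U by
      rw [hUV]; exact V.one_mem)
  refine ⟨A, fun g hg => ?_⟩
  have : g ∈ (fun (g : M ≃[L] M) (x : M) => g x) ⁻¹' U := by
    refine hAu fun x hx => ?_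
    have hgx : g x = x := (mem_fixingSubgroup_iff _).1 hg x hx
    change g x ∈ u x
    rw [hgx]
    exact (hu x hx).2
  rwa [hUV] at this

theorem weaklyEliminatesImaginaries_of_le_sup {L : FirstOrder.Language.{u, v}} {M : Type w}
    [L.Structure M] [DecidableEq M]
    (h : ∀ (C : Finset M) (a b : M), a ∉ C → b ∉ C → a ≠ b →
      fixingSubgroup (M ≃[L] M) (C : Set M) ≤
        fixingSubgroup (M ≃[L] M) ((insert a C : Finset M) : Set M) ⊔
          fixingSubgroup (M ≃[L] M) ((insert b C : Finset M) : Set M)) :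
    WeaklyEliminatesImaginaries L M := by
  intro V _ hV
  obtain ⟨A₀, hA₀⟩ := exists_fixingSubgroup_le_of_isOpen V hV
  obtain ⟨A, hA, hfin⟩ := exists_fixingSubgroup_le_isFiniteRelIndex h V A₀ hA₀
  have hrange : Set.range (fun i => (A.equivFin.symm i : M)) = A := by
    ext x
    exact ⟨by rintro ⟨i, rfl⟩; exact (A.equivFin.symm i).2,
      fun hx => ⟨A.equivFin ⟨x, hx⟩, by simp⟩⟩
  refine ⟨A.card, fun i => A.equivFin.symm i, ?_⟩
  rw [tupleStabilizer, hrange]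
  exact ⟨hA, hfin⟩

/-! ### Realizing the limit structure on the sphere of an inner product space -/

open scoped InnerProductSpace

theorem affineIndependent_option_elim_zero {ι E : Type*} [AddCommGroup E] [Module ℝ E]
    {f : ι → E} :
    AffineIndependent ℝ (fun o : Option ι => o.elim (0 : E) f) ↔ LinearIndependent ℝ f := by
  rw [affineIndependent_iff_linearIndependent_vsub ℝ _ none]
  let e : ι ≃ {x : Option ι // x ≠ none} :=
    { toFun := fun i => ⟨some i, by simp⟩
      invFun := fun x => x.1.get (Option.isSome_iff_ne_none.2 x.2)
      left_inv := fun i => by simp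
      right_inv := fun x => by simp }
  rw [← linearIndependent_equiv e]
  simp [e, Function.comp_def]

/-- A map `f` from `M` to a real inner product space realizes the `S`-metric structure `M` on the
unit sphere if it is a linearly independent family of unit vectors, with mutual distances in `S`
given by the relations of `M`. -/
structure IsSphericalRealization {S : Set ℝ} {M : Type*} [(metricLanguage S).Structure M]
    {E : Type*} [NormedAddCommGroup E] [InnerProductSpace ℝ E] (f : M → E) : Prop where
  linearIndependent : LinearIndependent ℝ f
  norm_eq_one : ∀ x, ‖f x‖ = 1
  dist_mem : ∀ x y, x ≠ y → dist (f x) (f y) ∈ S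
  relMap_iff : ∀ (s : S) (x y : M),
    FirstOrder.Language.Structure.RelMap (distSymbol s) ![x, y] ↔ dist (f x) (f y) = s

section Realization

variable {S : Set ℝ} {M : Type w} [(metricLanguage S).Structure M]

theorem mem_sphericalClass_iff {X : CategoryTheory.Bundled.{w} (metricLanguage S).Structure} :
    X ∈ sphericalClass S ↔
      Finite X ∧ ∃ (n : ℕ) (f : X → EuclideanSpace ℝ (Fin n)),
        IsSphericalRealization (S := S) f := by
  refine and_congr_right fun _ => exists_congr fun n => exists_congr fun f => ?_
  simp only [affineIndependent_option_elim_zero, mem_sphere_zero_iff_norm]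
  exact ⟨fun ⟨h₁, h₂, h₃, h₄⟩ => ⟨h₂, h₁, h₃, h₄⟩, fun ⟨h₂, h₁, h₃, h₄⟩ => ⟨h₁, h₂, h₃, h₄⟩⟩

theorem IsSphericalRealization.mem_sphericalClass [Finite M]
    {E : Type*} [NormedAddCommGroup E] [InnerProductSpace ℝ E] {f : M → E}
    (hf : IsSphericalRealization (S := S) f) :
    (⟨M, inferInstance⟩ : CategoryTheory.Bundled.{w} (metricLanguage S).Structure) ∈
      sphericalClass S := by
  refine mem_sphericalClass_iff.2 ⟨‹Finite M›, ?_⟩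
  let U := Submodule.span ℝ (Set.range f)
  have : FiniteDimensional ℝ U := FiniteDimensional.span_of_finite ℝ (Set.finite_range f)
  let e := (stdOrthonormalBasis ℝ U).repr
  let g : M → U := fun x => ⟨f x, Submodule.subset_span ⟨x, rfl⟩⟩
  have hd : ∀ x y, dist (e (g x)) (e (g y)) = dist (f x) (f y) := fun x y => by
    rw [e.dist_map]; rfl
  refine ⟨_, fun x => e (g x), ?_, fun x => ?_, fun x y hxy => ?_, fun s x y => ?_⟩
  · have hg : LinearIndependent ℝ g :=
      LinearIndependent.of_comp U.subtype hf.linearIndependent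
    exact hg.map' e.toLinearEquiv.toLinearMap e.toLinearEquiv.ker
  · rw [e.norm_map]; exact hf.norm_eq_one x
  · rw [hd]; exact hf.dist_mem x y hxy
  · rw [hd]; exact hf.relMap_iff s x y

theorem relMap_distSymbol_embedding {N : Type*} [(metricLanguage S).Structure N]
    (e : N ↪[metricLanguage S] M) (s : S) (x y : N) :
    FirstOrder.Language.Structure.RelMap (distSymbol s) ![e x, e y] ↔
      FirstOrder.Language.Structure.RelMap (distSymbol s) ![x, y] := by
  rw [← e.map_rel (distSymbol s) ![x, y] ]
  exact iff_of_eq (congrArg _ (by ext i; fin_cases i <;> rfl))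

/-- The distance encoded by the relations of an `S`-metric structure. -/
noncomputable def structureDist (x y : M) : ℝ :=
  open scoped Classical in
  if h : ∃ s : S, FirstOrder.Language.Structure.RelMap (distSymbol s) ![x, y] then h.choose else 0

theorem IsSphericalRealization.structureDist_eq {N : Type*} [(metricLanguage S).Structure N]
    {E : Type*} [NormedAddCommGroup E] [InnerProductSpace ℝ E] {f : N → E}
    (hf : IsSphericalRealization (S := S) f) (e : N ↪[metricLanguage S] M) (x y : N) :
    structureDist (S := S) (e x) (e y) = dist (f x) (f y) := by
  have he : ∀ s : S, FirstOrder.Language.Structure.RelMap (distSymbol s) ![e x, e y] ↔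
      dist (f x) (f y) = s := fun s => by
    rw [← hf.relMap_iff, relMap_distSymbol_embedding e]
  rw [structureDist]
  split_ifs with h
  · exact ((he _).1 h.choose_spec).symm
  -- No relation holds only when `x = y`, where the default value `0` is the correct distance.
  · by_contra hne
    refine h ⟨⟨dist (f x) (f y), hf.dist_mem x y ?_⟩, (he _).2 rfl⟩
    rintro rfl
    simp at hne

/-- The form on the free vector space over an `S`-metric structure whose values on basis vectors
are the inner products `1 - d(x, y) ^ 2 / 2` of unit vectors at distance `d(x, y)`. -/
noncomputable def structureForm (S : Set ℝ) (M : Type w) [(metricLanguage S).Structure M] :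
    (M →₀ ℝ) →ₗ[ℝ] (M →₀ ℝ) →ₗ[ℝ] ℝ :=
  Finsupp.lsum ℝ fun x => LinearMap.lsmul ℝ _ |>.flip
    (Finsupp.lsum ℝ fun y => LinearMap.lsmul ℝ ℝ (1 - structureDist (S := S) x y ^ 2 / 2))

theorem structureForm_single (x y : M) (a b : ℝ) :
    structureForm S M (Finsupp.single x a) (Finsupp.single y b) =
      a * b * (1 - structureDist (S := S) x y ^ 2 / 2) := by
  simp [structureForm]
  ring

theorem inner_eq_of_norm_eq_one {E : Type*} [NormedAddCommGroup E] [InnerProductSpace ℝ E]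
    {x y : E} (hx : ‖x‖ = 1) (hy : ‖y‖ = 1) : ⟪x, y⟫_ℝ = 1 - dist x y ^ 2 / 2 := by
  rw [dist_eq_norm, norm_sub_sq_real, hx, hy]
  ring

/-- On vectors supported on the image of a realized structure, the form is given by the
realization. -/
theorem IsSphericalRealization.structureForm_eq {N : Type*} [(metricLanguage S).Structure N]
    {E : Type*} [NormedAddCommGroup E] [InnerProductSpace ℝ E] {f : N → E}
    (hf : IsSphericalRealization (S := S) f) (e : N ↪[metricLanguage S] M) (u v : N →₀ ℝ) :
    structureForm S M (u.mapDomain e) (v.mapDomain e) =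
      ⟪Finsupp.linearCombination ℝ f u, Finsupp.linearCombination ℝ f v⟫_ℝ := by
  induction u using Finsupp.induction_linear with
  | zero => simp
  | add u₁ u₂ h₁ h₂ => simp [Finsupp.mapDomain_add, inner_add_left, h₁, h₂]
  | single x a =>
    induction v using Finsupp.induction_linear with
    | zero => simp
    | add u₁ u₂ h₁ h₂ => simp [Finsupp.mapDomain_add, inner_add_right] at h₁ h₂ ⊢; rw [h₁, h₂]
    | single y b =>
      rw [Finsupp.mapDomain_single, Finsupp.mapDomain_single, structureForm_single,
        hf.structureDist_eq, Finsupp.linearCombination_single, Finsupp.linearCombination_single,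
        real_inner_smul_left, real_inner_smul_right,
        inner_eq_of_norm_eq_one (hf.norm_eq_one x) (hf.norm_eq_one y)]
      ring

/-- Every finite subset of an `S`-metric structure whose age consists of spherical structures is
realized on a sphere. -/
theorem exists_isSphericalRealization_of_finite
    (hM : (metricLanguage S).age M ⊆ sphericalClass S) {A : Set M} (hA : A.Finite) :
    ∃ (N : Type w) (_ : (metricLanguage S).Structure N) (e : N ↪[metricLanguage S] M) (n : ℕ)
      (f : N → EuclideanSpace ℝ (Fin n)), IsSphericalRealization (S := S) f ∧ Set.range e = A := by
  let T := FirstOrder.Language.Substructure.closure (metricLanguage S) A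
  have hT : T.FG := FirstOrder.Language.Substructure.fg_closure hA
  obtain ⟨_, n, f, hf⟩ := mem_sphericalClass_iff.1
    (hM (FirstOrder.Language.age.fg_substructure hT))
  refine ⟨T, inferInstance, T.subtype, n, f, hf, ?_⟩
  have : Set.range T.subtype = (T : Set M) := Subtype.range_coe
  rw [this]
  exact FirstOrder.Language.Substructure.closure_eq_of_isRelational _ A

/-- The structure form is positive definite on vectors of finite support. -/
theorem structureForm_pos (hM : (metricLanguage S).age M ⊆ sphericalClass S) {u : M →₀ ℝ}
    (hu : u ≠ 0) : 0 < structureForm S M u u := by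
  obtain ⟨N, _, e, n, f, hf, he⟩ :=
    exists_isSphericalRealization_of_finite hM u.support.finite_toSet
  have hv := Finsupp.mapDomain_comapDomain e e.injective u he.ge
  rw [← hv, hf.structureForm_eq e, real_inner_self_pos]
  intro h0
  have := linearIndependent_iff.1 hf.linearIndependent _ h0
  rw [this, Finsupp.mapDomain_zero] at hv
  exact hu hv.symm

theorem structureForm_symm (hM : (metricLanguage S).age M ⊆ sphericalClass S) (u v : M →₀ ℝ) :
    structureForm S M u v = structureForm S M v u := by
  classical
  obtain ⟨N, _, e, n, f, hf, he⟩ :=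
    exists_isSphericalRealization_of_finite hM (u.support ∪ v.support).finite_toSet
  rw [← Finsupp.mapDomain_comapDomain e e.injective u (by rw [he]; simp),
    ← Finsupp.mapDomain_comapDomain e e.injective v (by rw [he]; simp),
    hf.structureForm_eq e, hf.structureForm_eq e, real_inner_comm]

/-- A structure whose age consists of spherical structures is realized on the unit sphere of a
real inner product space. -/
theorem exists_isSphericalRealization (hM : (metricLanguage S).age M ⊆ sphericalClass S) :
    ∃ (E : Type w) (_ : NormedAddCommGroup E) (_ : InnerProductSpace ℝ E) (f : M → E),
      IsSphericalRealization (S := S) f := by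
  let core : InnerProductSpace.Core ℝ (M →₀ ℝ) :=
    { inner := fun u v => structureForm S M u v
      conj_inner_symm := fun u v => structureForm_symm hM v u
      re_inner_nonneg := fun u => by
        rcases eq_or_ne u 0 with rfl | hu
        · simp
        · exact (structureForm_pos hM hu).le
      add_left := fun u v z => by simp
      smul_left := fun u v r => by simp
      definite := fun u hu => by
        by_contra hne
        exact (structureForm_pos hM hne).ne' hu }
  let _ : NormedAddCommGroup (M →₀ ℝ) := core.toNormedAddCommGroup
  let _ : InnerProductSpace ℝ (M →₀ ℝ) := InnerProductSpace.ofCore core.toCore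
  let f : M → M →₀ ℝ := fun x => Finsupp.single x 1
  have hinner : ∀ u v : M →₀ ℝ, ⟪u, v⟫_ℝ = structureForm S M u v := fun _ _ => rfl
  have key : ∀ x y : M, ‖f x‖ = 1 ∧ (x ≠ y → dist (f x) (f y) ∈ S) ∧
      ∀ s : S, FirstOrder.Language.Structure.RelMap (distSymbol s) ![x, y] ↔
        dist (f x) (f y) = s := by
    intro x y
    obtain ⟨N, _, e, n, g, hg, he⟩ :=
      exists_isSphericalRealization_of_finite hM (Set.toFinite {x, y})
    obtain ⟨x, rfl⟩ : x ∈ Set.range e := by rw [he]; simp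
    obtain ⟨y, rfl⟩ : y ∈ Set.range e := by rw [he]; simp
    have hfe : ∀ z, f (e z) = Finsupp.mapDomain e (Finsupp.single z 1) := fun z => by
      rw [Finsupp.mapDomain_single]
    have hg' : ∀ u v : N →₀ ℝ, ⟪u.mapDomain e, v.mapDomain e⟫_ℝ = _ :=
      fun u v => (hinner _ _).trans (hg.structureForm_eq e u v)
    have hnorm : ∀ u : N →₀ ℝ, ‖u.mapDomain e‖ = ‖Finsupp.linearCombination ℝ g u‖ := fun u => by
      rw [← sq_eq_sq₀ (norm_nonneg _) (norm_nonneg _), ← real_inner_self_eq_norm_sq,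
        ← real_inner_self_eq_norm_sq, hg']
    have hdist : dist (f (e x)) (f (e y)) = dist (g x) (g y) := by
      have h := hnorm (Finsupp.single x 1 - Finsupp.single y 1)
      have hs : Finsupp.mapDomain e (Finsupp.single x (1 : ℝ) - Finsupp.single y 1) =
          f (e x) - f (e y) := by
        rw [hfe, hfe]
        exact map_sub (Finsupp.lmapDomain ℝ ℝ e) _ _
      rw [hs] at h
      rw [dist_eq_norm, dist_eq_norm, h]
      simp
    rw [hdist]
    refine ⟨by rw [hfe, hnorm]; simpa using hg.norm_eq_one x,
      fun hxy => hg.dist_mem x y fun h => hxy (by rw [h]), fun s => ?_⟩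
    rw [← hg.relMap_iff, relMap_distSymbol_embedding e]
  exact ⟨M →₀ ℝ, inferInstance, inferInstance, f, Finsupp.linearIndependent_single_one ℝ M,
    fun x => (key x x).1, fun x y => (key x y).2.1, fun s x y => (key x y).2.2 s⟩

end Realization

/-! ### Homogeneity and the extension property in terms of inner products -/

section Extension

variable {S : Set ℝ} {M : Type w} [(metricLanguage S).Structure M]
  {E : Type*} [NormedAddCommGroup E] [InnerProductSpace ℝ E] {f : M → E}

theorem IsSphericalRealization.dist_embedding {N : Type*} [(metricLanguage S).Structure N]
    {E' : Type*} [NormedAddCommGroup E'] [InnerProductSpace ℝ E'] {g : N → E'}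
    (hf : IsSphericalRealization (S := S) f) (hg : IsSphericalRealization (S := S) g)
    (e : N ↪[metricLanguage S] M) (x y : N) : dist (f (e x)) (f (e y)) = dist (g x) (g y) := by
  rw [← hg.structureDist_eq e,
    ← hf.structureDist_eq (FirstOrder.Language.Embedding.refl (metricLanguage S) M)]
  rfl

theorem IsSphericalRealization.inner_eq (hf : IsSphericalRealization (S := S) f) (x y : M) :
    ⟪f x, f y⟫_ℝ = 1 - dist (f x) (f y) ^ 2 / 2 :=
  inner_eq_of_norm_eq_one (hf.norm_eq_one x) (hf.norm_eq_one y)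

theorem IsSphericalRealization.inner_self (hf : IsSphericalRealization (S := S) f) (x : M) :
    ⟪f x, f x⟫_ℝ = 1 := by
  rw [hf.inner_eq, dist_self]; norm_num

theorem IsSphericalRealization.dist_eq (hf : IsSphericalRealization (S := S) f) (x y : M) :
    dist (f x) (f y) = √(2 - 2 * ⟪f x, f y⟫_ℝ) := by
  rw [hf.inner_eq, show 2 - 2 * (1 - dist (f x) (f y) ^ 2 / 2) = dist (f x) (f y) ^ 2 by ring,
    Real.sqrt_sq dist_nonneg]

theorem IsSphericalRealization.inner_eq_one_iff (hf : IsSphericalRealization (S := S) f)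
    {x y : M} : ⟪f x, f y⟫_ℝ = 1 ↔ x = y := by
  rw [inner_eq_one_iff_of_norm_eq_one (hf.norm_eq_one x) (hf.norm_eq_one y)]
  exact hf.linearIndependent.injective.eq_iff

theorem IsSphericalRealization.inner_map_map (hf : IsSphericalRealization (S := S) f)
    (g : M ≃[metricLanguage S] M) (x y : M) : ⟪f (g x), f (g y)⟫_ℝ = ⟪f x, f y⟫_ℝ := by
  have h : dist (f (g x)) (f (g y)) = dist (f x) (f y) := hf.dist_embedding hf g.toEmbedding x y
  rw [hf.inner_eq, hf.inner_eq, h]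

/-- In an ultrahomogeneous structure, finite partial isometries extend to automorphisms. -/
theorem IsSphericalRealization.exists_equiv_of_inner_eq
    (hf : IsSphericalRealization (S := S) f)
    (hM : (metricLanguage S).IsUltrahomogeneous M) {A : Set M} (hA : A.Finite) (φ : A → M)
    (hφ : ∀ x y : A, ⟪f (φ x), f (φ y)⟫_ℝ = ⟪f x, f y⟫_ℝ) :
    ∃ g : M ≃[metricLanguage S] M, ∀ x : A, g x = φ x := by
  have hmem : ∀ x, x ∈ FirstOrder.Language.Substructure.closure (metricLanguage S) A ↔ x ∈ A :=
    FirstOrder.Language.Substructure.mem_closure_iff_of_isRelational _ A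
  let T := FirstOrder.Language.Substructure.closure (metricLanguage S) A
  let ψ : T → M := fun x => φ ⟨x, (hmem x).1 x.2⟩
  have hψ : ∀ x y : T, dist (f (ψ x)) (f (ψ y)) = dist (f x) (f y) := fun x y => by
    rw [hf.dist_eq, hf.dist_eq, hφ]
  let e : T ↪[metricLanguage S] M :=
    { toFun := ψ
      inj' := fun x y hxy => by
        have := hψ x y
        rw [hxy, dist_self, eq_comm, dist_eq_zero] at this
        exact Subtype.ext (hf.linearIndependent.injective this)
      map_fun' := fun r => isEmptyElim r
      map_rel' := fun {n} r x => by
        cases r with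
        | dist s =>
          have hx : ψ ∘ x = ![ψ (x 0), ψ (x 1)] := by ext i; fin_cases i <;> rfl
          have hx' : x = ![x 0, x 1] := by ext i; fin_cases i <;> rfl
          have h₁ := hf.relMap_iff s (ψ (x 0)) (ψ (x 1))
          have h₂ := hf.relMap_iff s (x 0) (x 1)
          have h₃ := relMap_distSymbol_embedding T.subtype s (x 0) (x 1)
          rw [hψ, ← h₂] at h₁
          rw [hx, hx']
          exact h₁.trans h₃ }
  obtain ⟨g, hg⟩ := hM T (FirstOrder.Language.Substructure.fg_closure hA) e
  refine ⟨g, fun x => ?_⟩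
  have := DFunLike.congr_fun hg ⟨x, (hmem x).2 x.2⟩
  exact this.symm

/-- Inner products with `C` determine the type over `C`: fixing `C` and sending `a` to `a'` is a
partial isometry. -/
theorem IsSphericalRealization.exists_mem_fixingSubgroup
    (hf : IsSphericalRealization (S := S) f)
    (hM : (metricLanguage S).IsUltrahomogeneous M) {C : Finset M} {a a' : M} (ha : a ∉ C)
    (h : ∀ c ∈ C, ⟪f a', f c⟫_ℝ = ⟪f a, f c⟫_ℝ) :
    ∃ g ∈ fixingSubgroup (M ≃[metricLanguage S] M) (C : Set M), g a = a' := by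
  classical
  obtain ⟨g, hg⟩ := hf.exists_equiv_of_inner_eq hM (insert a C).finite_toSet
    (fun x => if (x : M) = a then a' else x) (fun x y => by
      obtain ⟨x, hx⟩ := x
      obtain ⟨y, hy⟩ := y
      rw [Finset.mem_coe, Finset.mem_insert] at hx hy
      dsimp only
      split_ifs with hxa hya hya
      · rw [hxa, hya, hf.inner_self, hf.inner_self]
      · rw [hxa, h y (hy.resolve_left hya)]
      · rw [hya, real_inner_comm, h x (hx.resolve_left hxa), real_inner_comm]
      · rfl)
  refine ⟨g, ?_, by simpa using hg ⟨a, by simp⟩⟩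
  rw [mem_fixingSubgroup_iff]
  intro c hc
  have := hg ⟨c, by simp [Finset.mem_coe.1 hc]⟩
  rwa [if_neg (fun h : c = a => ha (h ▸ hc))] at this

/-- A vector of norm less than one whose inner products with finitely many points are admissible
can be replaced by a point of the limit structure. -/
theorem IsSphericalRealization.exists_inner_eq [Countable M]
    (hf : IsSphericalRealization (S := S) f)
    (hM : FirstOrder.Language.IsFraisseLimit (sphericalClass.{w} S) M) {A : Set M}
    (hA : A.Finite) {x : E} (hx : ‖x‖ < 1) (hS : ∀ a ∈ A, √(2 - 2 * ⟪x, f a⟫_ℝ) ∈ S) :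
    ∃ m : M, ∀ a ∈ A, ⟪f m, f a⟫_ℝ = ⟪x, f a⟫_ℝ := by
  have : Finite A := hA
  -- Lift `x` to the unit sphere with a new orthogonal coordinate. This keeps its inner products
  -- with the old points, and since the coordinate is nonzero, `z` is independent of them.
  let z : WithLp 2 (E × ℝ) := WithLp.toLp 2 (x, √(1 - ‖x‖ ^ 2))
  let f' : A → WithLp 2 (E × ℝ) := fun a => WithLp.toLp 2 (f a, 0)
  let g : Option A → WithLp 2 (E × ℝ) := fun o => o.elim z f'
  have hpos : 0 < 1 - ‖x‖ ^ 2 := by nlinarith [norm_nonneg x]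
  have hz : ‖z‖ = 1 := by
    rw [← sq_eq_sq₀ (norm_nonneg _) zero_le_one, WithLp.prod_norm_sq_eq_of_L2]
    simp [z, Real.sq_sqrt hpos.le]
  have hf' : ∀ a, ‖f' a‖ = 1 := fun a => by
    rw [← sq_eq_sq₀ (norm_nonneg _) zero_le_one, WithLp.prod_norm_sq_eq_of_L2]
    simp [f', hf.norm_eq_one]
  have hzf : ∀ a, ⟪z, f' a⟫_ℝ = ⟪x, f a⟫_ℝ := fun a => by
    simp [z, f', WithLp.prod_inner_apply]
  have hff : ∀ a b, ⟪f' a, f' b⟫_ℝ = ⟪f a, f b⟫_ℝ := fun a b => by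
    simp [f', WithLp.prod_inner_apply]
  have hdist : ∀ u v : WithLp 2 (E × ℝ), ‖u‖ = 1 → ‖v‖ = 1 →
      dist u v = √(2 - 2 * ⟪u, v⟫_ℝ) := fun u v hu hv => by
    rw [inner_eq_of_norm_eq_one hu hv, show 2 - 2 * (1 - dist u v ^ 2 / 2) = dist u v ^ 2 by ring,
      Real.sqrt_sq dist_nonneg]
  let _ : (metricLanguage S).Structure (Option A) :=
    { funMap := fun r => isEmptyElim r
      RelMap := fun {n} r => match n, r with
        | _, DistRel.dist s => fun v => dist (g (v 0)) (g (v 1)) = s }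
  have hg : IsSphericalRealization (S := S) g := by
    refine ⟨linearIndependent_option.2 ⟨?_, ?_⟩, ?_, ?_, fun s x y => Iff.rfl⟩
    · refine LinearIndependent.of_comp (WithLp.fstₗ 2 ℝ E ℝ) ?_
      exact hf.linearIndependent.comp _ Subtype.val_injective
    · intro hmem
      have hle : Submodule.span ℝ (Set.range (g ∘ some)) ≤ LinearMap.ker (WithLp.sndₗ 2 ℝ E ℝ) := by
        rw [Submodule.span_le]
        rintro _ ⟨a, rfl⟩
        simp [g, f']
      have := hle hmem
      simp only [g, z, LinearMap.mem_ker, Option.elim] at this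
      exact (Real.sqrt_pos.2 hpos).ne' this
    · rintro (_ | a)
      · exact hz
      · exact hf' a
    · have hza : ∀ a, dist z (f' a) ∈ S := fun a => by
        rw [hdist _ _ hz (hf' a), hzf]
        exact hS a a.2
      rintro (_ | a) (_ | b) hab
      · exact (hab rfl).elim
      · exact hza b
      · rw [dist_comm]; exact hza a
      · change dist (f' a) (f' b) ∈ S
        rw [hdist _ _ (hf' a) (hf' b), hff, ← hf.dist_eq]
        exact hf.dist_mem a b fun h => hab (by rw [Subtype.ext h])
  obtain ⟨-, ⟨e⟩⟩ := hM.age.symm ▸ hg.mem_sphericalClass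
  have he : ∀ o o', ⟪f (e o), f (e o')⟫_ℝ = ⟪g o, g o'⟫_ℝ := fun o o' => by
    have hnorm : ∀ o, ‖g o‖ = 1 := hg.norm_eq_one
    rw [hf.inner_eq, hf.dist_embedding hg e, inner_eq_of_norm_eq_one (hnorm o) (hnorm o')]
  -- The copy of `Option A` given by the age need not contain `A` itself; an automorphism carries
  -- `A` onto its copy, and its inverse brings the new point back.
  obtain ⟨h, hh⟩ := hf.exists_equiv_of_inner_eq hM.ultrahomogeneous hA (fun a => e (some a))
    (fun a b => (he _ _).trans (hff a b))
  refine ⟨h.symm (e none), fun a ha => ?_⟩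
  rw [← hf.inner_map_map h, h.apply_symm_apply, hh ⟨a, ha⟩, he]
  exact hzf ⟨a, ha⟩

end Extension

/-! ### Orthogonal projections and vectors equidistant from two points -/

section Geometry

variable {E : Type*} [NormedAddCommGroup E] [InnerProductSpace ℝ E]

theorem Submodule.starProjection_eq_of_inner_eq (s : Set E)
    [(Submodule.span ℝ s).HasOrthogonalProjection] {u v : E}
    (h : ∀ c ∈ s, ⟪u, c⟫_ℝ = ⟪v, c⟫_ℝ) :
    (Submodule.span ℝ s).starProjection u = (Submodule.span ℝ s).starProjection v := by
  rw [← sub_eq_zero, ← map_sub, Submodule.starProjection_apply_eq_zero_iff,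
    Submodule.mem_orthogonal']
  intro c hc
  induction hc using Submodule.span_induction with
  | mem c hc => rw [inner_sub_left, h c hc, sub_self]
  | zero => exact inner_zero_right _
  | add x y _ _ hx hy => rw [inner_add_right, hx, hy, add_zero]
  | smul r x _ hx => rw [real_inner_smul_right, hx, mul_zero]

theorem Submodule.inner_eq_inner_starProjection (W : Submodule ℝ E) [W.HasOrthogonalProjection]
    (u : E) {c : E} (hc : c ∈ W) : ⟪u, c⟫_ℝ = ⟪W.starProjection u, c⟫_ℝ := by
  rw [← sub_eq_zero, ← inner_sub_left]
  exact W.starProjection_inner_eq_zero u c hc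

theorem Submodule.inner_starProjection_self (W : Submodule ℝ E) [W.HasOrthogonalProjection]
    (u : E) : ⟪W.starProjection u, u⟫_ℝ = ‖W.starProjection u‖ ^ 2 := by
  rw [real_inner_comm, W.inner_eq_inner_starProjection u (W.starProjection_apply_mem u),
    real_inner_self_eq_norm_sq]

theorem norm_add_sub_two_smul_starProjection_sq (W : Submodule ℝ E) [W.HasOrthogonalProjection]
    {u v : E} (hu : ‖u‖ = 1) (hv : ‖v‖ = 1) (huv : W.starProjection v = W.starProjection u) :
    ‖u + v - (2 : ℝ) • W.starProjection u‖ ^ 2 =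
      2 * (1 + ⟪u, v⟫_ℝ - 2 * ‖W.starProjection u‖ ^ 2) := by
  have hpu := W.inner_starProjection_self u
  have hpv := W.inner_starProjection_self v
  rw [huv] at hpv
  rw [norm_sub_sq_real, norm_add_sq_real, hu, hv, real_inner_smul_right,
    real_inner_comm _ (u + v), inner_add_right, hpu, hpv, norm_smul]
  norm_num
  ring

/-- For unit vectors `u`, `v` with the same projection to `W`, there is a vector of norm less
than one with projection `q` to `W` and prescribed equal inner products with `u` and `v`. -/
theorem exists_inner_eq_of_starProjection_eq (W : Submodule ℝ E) [W.HasOrthogonalProjection]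
    {u v q : E} (hu : ‖u‖ = 1) (hv : ‖v‖ = 1) (huv : W.starProjection v = W.starProjection u)
    (hq : q ∈ W) {t : ℝ}
    (hpos : 0 < 1 + ⟪u, v⟫_ℝ - 2 * ‖W.starProjection u‖ ^ 2)
    (ht : 2 * t ^ 2 < (1 - ‖q‖ ^ 2) * (1 + ⟪u, v⟫_ℝ - 2 * ‖W.starProjection u‖ ^ 2)) :
    ∃ x : E, ‖x‖ < 1 ∧ ⟪x, u⟫_ℝ = ⟪q, u⟫_ℝ + t ∧ ⟪x, v⟫_ℝ = ⟪q, u⟫_ℝ + t ∧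
      ∀ c ∈ W, ⟪x, c⟫_ℝ = ⟪q, c⟫_ℝ := by
  have hu' := fun c => W.inner_eq_inner_starProjection u (c := c)
  have hv' := fun c => W.inner_eq_inner_starProjection v (c := c)
  have hpu := W.inner_starProjection_self u
  have hpv := W.inner_starProjection_self v
  have hrr := norm_add_sub_two_smul_starProjection_sq W hu hv huv
  rw [huv] at hpv hv'
  have huu : ⟪u, u⟫_ℝ = 1 := by rw [real_inner_self_eq_norm_sq, hu, one_pow]
  have hvv : ⟪v, v⟫_ℝ = 1 := by rw [real_inner_self_eq_norm_sq, hv, one_pow]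
  have hqv : ⟪q, v⟫_ℝ = ⟪q, u⟫_ℝ := by
    rw [real_inner_comm, hv' q hq, ← hu' q hq, real_inner_comm]
  set D := 1 + ⟪u, v⟫_ℝ - 2 * ‖W.starProjection u‖ ^ 2 with hD
  -- The sum of the components of `u` and `v` orthogonal to `W`: it has inner product `D` with both,
  -- and squared norm `2 * D`.
  set r : E := u + v - (2 : ℝ) • W.starProjection u with hr
  have hrW : ∀ c ∈ W, ⟪r, c⟫_ℝ = 0 := fun c hc => by
    rw [hr, inner_sub_left, inner_add_left, real_inner_smul_left, hu' c hc, hv' c hc]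
    ring
  have hru : ⟪r, u⟫_ℝ = D := by
    rw [hr, inner_sub_left, inner_add_left, real_inner_smul_left, huu, hpu, real_inner_comm, hD]
  have hrv : ⟪r, v⟫_ℝ = D := by
    rw [hr, inner_sub_left, inner_add_left, real_inner_smul_left, hvv, hpv, hD]
    ring
  -- The squared norm is `‖q‖ ^ 2 + 2 * t ^ 2 / D`, so `ht` says exactly that it is below `1`.
  refine ⟨q + (t / D) • r, ?_, ?_, ?_, fun c hc => ?_⟩
  · rw [← sq_lt_one_iff₀ (norm_nonneg _), norm_add_sq_real, real_inner_smul_right,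
      real_inner_comm, hrW q hq, norm_smul, mul_pow, hrr, Real.norm_eq_abs, sq_abs, div_pow]
    have : t ^ 2 / D ^ 2 * (2 * D) = 2 * t ^ 2 / D := by field_simp
    rw [this]
    have := (div_lt_iff₀ hpos).2 ht
    linarith
  · rw [inner_add_left, real_inner_smul_left, hru, div_mul_cancel₀ _ hpos.ne']
  · rw [inner_add_left, real_inner_smul_left, hrv, div_mul_cancel₀ _ hpos.ne', hqv]
  · rw [inner_add_left, real_inner_smul_left, hrW c hc, mul_zero, add_zero]

theorem inner_sub_starProjection_sub_starProjection (W : Submodule ℝ E)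
    [W.HasOrthogonalProjection] (u v : E) :
    ⟪u - W.starProjection u, v - W.starProjection v⟫_ℝ =
      ⟪u, v⟫_ℝ - ⟪W.starProjection u, v⟫_ℝ := by
  rw [inner_sub_right, W.starProjection_inner_eq_zero u _ (W.starProjection_apply_mem v),
    sub_zero, inner_sub_left]

end Geometry

/-! ### Common points and midpoints -/

section OnePoint

variable {S : Set ℝ} {M : Type w} [(metricLanguage S).Structure M]
  {E : Type*} [NormedAddCommGroup E] [InnerProductSpace ℝ E] {f : M → E}

/-- This is half the squared norm of `f a + f a' - 2 • p`, with `p` the common projection; its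
vanishing would put `f a` in the span of `f a'` and `f '' C`. -/
theorem IsSphericalRealization.one_add_inner_sub_pos (hf : IsSphericalRealization (S := S) f)
    {C : Finset M} [(Submodule.span ℝ (f '' C)).HasOrthogonalProjection] {a a' : M} (ha : a ∉ C)
    (hne : a ≠ a') (h : ∀ c ∈ f '' C, ⟪f a', c⟫_ℝ = ⟪f a, c⟫_ℝ) :
    0 < 1 + ⟪f a, f a'⟫_ℝ - 2 * ‖(Submodule.span ℝ (f '' C)).starProjection (f a)‖ ^ 2 := by
  have hsq := norm_add_sub_two_smul_starProjection_sq (Submodule.span ℝ (f '' C))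
    (hf.norm_eq_one a) (hf.norm_eq_one a') (Submodule.starProjection_eq_of_inner_eq _ h)
  set p := (Submodule.span ℝ (f '' C)).starProjection (f a) with hp
  suffices f a + f a' - (2 : ℝ) • p ≠ 0 by
    have := pow_pos (norm_pos_iff.2 this) 2
    linarith
  intro h0
  have hle : Submodule.span ℝ (f '' C) ≤ Submodule.span ℝ (f '' (insert a' (C : Set M))) :=
    Submodule.span_mono (Set.image_mono (Set.subset_insert _ _))
  refine hf.linearIndependent.notMem_span_image (s := insert a' (C : Set M)) (x := a)
    (by simp [hne, ha]) ?_
  have : f a = (2 : ℝ) • p - f a' := by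
    rw [← sub_eq_zero, ← h0]
    abel
  rw [this]
  exact sub_mem (Submodule.smul_mem _ _ (hle (Submodule.starProjection_apply_mem _ _)))
    (Submodule.subset_span ⟨a', by simp, rfl⟩)

/-- Strict Cauchy–Schwarz for the components of `f a` and `f b` orthogonal to the span of `f '' C`,
which are linearly independent. -/
theorem IsSphericalRealization.inner_sub_sq_lt (hf : IsSphericalRealization (S := S) f)
    {C : Finset M} [(Submodule.span ℝ (f '' C)).HasOrthogonalProjection] {a b : M} (ha : a ∉ C)
    (hb : b ∉ C) (hne : a ≠ b) :
    (⟪f b, f a⟫_ℝ - ⟪(Submodule.span ℝ (f '' C)).starProjection (f b), f a⟫_ℝ) ^ 2 <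
      (1 - ‖(Submodule.span ℝ (f '' C)).starProjection (f b)‖ ^ 2) *
      (1 - ‖(Submodule.span ℝ (f '' C)).starProjection (f a)‖ ^ 2) := by
  set W := Submodule.span ℝ (f '' C) with hW
  have hnorm : ∀ x, ‖f x - W.starProjection (f x)‖ ^ 2 = 1 - ‖W.starProjection (f x)‖ ^ 2 :=
    fun x => by
      rw [← real_inner_self_eq_norm_sq, inner_sub_starProjection_sub_starProjection,
        hf.inner_self, W.inner_starProjection_self]
  rw [← hnorm, ← hnorm, ← inner_sub_starProjection_sub_starProjection]
  set α := f a - W.starProjection (f a) with hα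
  set β := f b - W.starProjection (f b) with hβ
  have hαne : α ≠ 0 := by
    intro h0
    refine hf.linearIndependent.notMem_span_image (s := (C : Set M)) ha ?_
    rw [sub_eq_zero.1 h0]
    exact Submodule.starProjection_apply_mem _ _
  have hρ : 0 < ‖α‖ ^ 2 := pow_pos (norm_pos_iff.2 hαne) 2
  have hδ : β - (⟪β, α⟫_ℝ / ‖α‖ ^ 2) • α ≠ 0 := by
    intro h0
    have hle : W ≤ Submodule.span ℝ (f '' (insert a (C : Set M))) :=
      Submodule.span_mono (Set.image_mono (Set.subset_insert _ _))
    refine hf.linearIndependent.notMem_span_image (s := insert a (C : Set M)) (x := b)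
      (by simp [hne.symm, hb]) ?_
    rw [← sub_add_cancel (f b) (W.starProjection (f b)), ← hβ, sub_eq_zero.1 h0]
    exact add_mem (Submodule.smul_mem _ _ (sub_mem (Submodule.subset_span ⟨a, by simp, rfl⟩)
      (hle (Submodule.starProjection_apply_mem _ _)))) (hle (Submodule.starProjection_apply_mem _ _))
  have hpos := pow_pos (norm_pos_iff.2 hδ) 2
  rw [norm_sub_sq_real, real_inner_smul_right, norm_smul, mul_pow, Real.norm_eq_abs,
    sq_abs] at hpos
  have : ‖β‖ ^ 2 - 2 * (⟪β, α⟫_ℝ / ‖α‖ ^ 2 * ⟪β, α⟫_ℝ) + (⟪β, α⟫_ℝ / ‖α‖ ^ 2) ^ 2 * ‖α‖ ^ 2 =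
      (‖β‖ ^ 2 * ‖α‖ ^ 2 - ⟪β, α⟫_ℝ ^ 2) / ‖α‖ ^ 2 := by
    field_simp
    ring
  rw [this, div_pos_iff_of_pos_right hρ] at hpos
  linarith

variable [Countable M]

/-- Two points of the same type over `C` that are close to each other have the same relation to
some point of the type of `b` over `C`. -/
theorem IsSphericalRealization.exists_common_point (hf : IsSphericalRealization (S := S) f)
    (hM : FirstOrder.Language.IsFraisseLimit (sphericalClass.{w} S) M)
    {C : Finset M} [(Submodule.span ℝ (f '' C)).HasOrthogonalProjection] {a a' b : M}
    (hb : b ∉ C) (hne : a ≠ b) (h : ∀ c ∈ f '' C, ⟪f a', c⟫_ℝ = ⟪f a, c⟫_ℝ)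
    (hclose : 2 * (⟪f b, f a⟫_ℝ -
        ⟪(Submodule.span ℝ (f '' C)).starProjection (f b), f a⟫_ℝ) ^ 2 <
      (1 - ‖(Submodule.span ℝ (f '' C)).starProjection (f b)‖ ^ 2) *
      (1 + ⟪f a, f a'⟫_ℝ - 2 * ‖(Submodule.span ℝ (f '' C)).starProjection (f a)‖ ^ 2)) :
    ∃ b' : M, (∀ c ∈ C, ⟪f b', f c⟫_ℝ = ⟪f b, f c⟫_ℝ) ∧
      ⟪f b', f a⟫_ℝ = ⟪f b, f a⟫_ℝ ∧ ⟪f b', f a'⟫_ℝ = ⟪f b, f a⟫_ℝ := by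
  set W := Submodule.span ℝ (f '' C) with hW
  have hle : 0 ≤ 1 - ‖W.starProjection (f b)‖ ^ 2 := by
    have := W.norm_starProjection_apply_le (f b)
    rw [hf.norm_eq_one] at this
    nlinarith [norm_nonneg (W.starProjection (f b))]
  -- Here `q` is the projection of `f b` and `t` the remainder of `⟪f b, f a⟫_ℝ`, so all prescribed
  -- values are inner products already realized by `b`; no density is needed.
  obtain ⟨x, hx, hxa, hxa', hxW⟩ := exists_inner_eq_of_starProjection_eq W
    (hf.norm_eq_one a) (hf.norm_eq_one a') (Submodule.starProjection_eq_of_inner_eq _ h)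
    (W.starProjection_apply_mem (f b))
    (pos_of_mul_pos_right ((mul_nonneg zero_le_two (sq_nonneg _)).trans_lt hclose) hle) hclose
  rw [add_sub_cancel] at hxa hxa'
  have hxC : ∀ c ∈ C, ⟪x, f c⟫_ℝ = ⟪f b, f c⟫_ℝ := fun c hc => by
    have hc' : f c ∈ W := Submodule.subset_span ⟨c, hc, rfl⟩
    rw [hxW _ hc', ← W.inner_eq_inner_starProjection _ hc']
  have hba : √(2 - 2 * ⟪f b, f a⟫_ℝ) ∈ S := by
    rw [← hf.dist_eq]
    exact hf.dist_mem b a hne.symm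
  obtain ⟨m, hm⟩ := hf.exists_inner_eq hM (A := {a, a'} ∪ (C : Set M)) (by simp) hx (by
    rintro c ((rfl | rfl) | hc)
    · rwa [hxa]
    · rwa [hxa']
    · rw [hxC c hc, ← hf.dist_eq]
      exact hf.dist_mem b c fun h => hb (h ▸ hc))
  exact ⟨m, fun c hc => (hm c (by simp [hc])).trans (hxC c hc), (hm a (by simp)).trans hxa,
    (hm a' (by simp)).trans hxa'⟩

/-- Two points of the same type over `C` have a point of this type over `C` in between. -/
theorem IsSphericalRealization.exists_midpoint (hS : Dense S)
    (hf : IsSphericalRealization (S := S) f)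
    (hM : FirstOrder.Language.IsFraisseLimit (sphericalClass.{w} S) M)
    {C : Finset M} [(Submodule.span ℝ (f '' C)).HasOrthogonalProjection] {a a' : M}
    (ha : a ∉ C) (hne : a ≠ a') (h : ∀ c ∈ f '' C, ⟪f a', c⟫_ℝ = ⟪f a, c⟫_ℝ) :
    ∃ m : M, (∀ c ∈ f '' C, ⟪f m, c⟫_ℝ = ⟪f a, c⟫_ℝ) ∧
      ⟪f m, f a⟫_ℝ = ⟪f m, f a'⟫_ℝ ∧ 1 - ⟪f m, f a⟫_ℝ < 3 / 4 * (1 - ⟪f a, f a'⟫_ℝ) := by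
  have hD := hf.one_add_inner_sub_pos ha hne h
  set W := Submodule.span ℝ (f '' C) with hW
  set P := ‖W.starProjection (f a)‖ ^ 2 with hP
  set k := ⟪f a, f a'⟫_ℝ with hk
  have hk1 : k < 1 := by
    rw [hk, hf.inner_eq]
    have := pow_pos (dist_pos.2 (hf.linearIndependent.injective.ne hne)) 2
    linarith
  have hy : √(1 - k) ^ 2 = 1 - k := Real.sq_sqrt (by linarith)
  -- `z` is the distance from the new point to `a` and `a'`. The value `√(1 - k)` corresponds to the
  -- linear midpoint `(f a + f a') / 2` but may lie outside `S`; the conditions are open, so a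
  -- nearby `z` in `S` works. The slack turns the factor `1 / 2` into `3 / 4`.
  let U : Set ℝ := {z | 0 < z} ∩ ({z | z ^ 2 / 2 < 3 / 4 * (1 - k)} ∩
    {z | 2 * (1 - z ^ 2 / 2 - P) ^ 2 < (1 - P) * (1 + k - 2 * P)})
  have hU : IsOpen U := (isOpen_lt continuous_const continuous_id).inter
    ((isOpen_lt (by fun_prop) continuous_const).inter (isOpen_lt (by fun_prop) continuous_const))
  obtain ⟨z, hzS, hz0, hz1, hz2⟩ := hS.exists_mem_open hU
    ⟨√(1 - k), Real.sqrt_pos.2 (by linarith),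
      show √(1 - k) ^ 2 / 2 < _ by rw [hy]; linarith,
      show 2 * (1 - √(1 - k) ^ 2 / 2 - P) ^ 2 < _ by rw [hy]; nlinarith⟩
  change 0 < z at hz0
  change z ^ 2 / 2 < _ at hz1
  change 2 * (1 - z ^ 2 / 2 - P) ^ 2 < _ at hz2
  obtain ⟨x, hx, hxa, hxa', hxW⟩ := exists_inner_eq_of_starProjection_eq W
    (hf.norm_eq_one a) (hf.norm_eq_one a') (Submodule.starProjection_eq_of_inner_eq _ h)
    (W.starProjection_apply_mem (f a)) hD hz2
  rw [W.inner_starProjection_self, ← hP, add_sub_cancel] at hxa hxa'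
  have hxC : ∀ c ∈ C, ⟪x, f c⟫_ℝ = ⟪f a, f c⟫_ℝ := fun c hc => by
    have hc' : f c ∈ W := Submodule.subset_span ⟨c, hc, rfl⟩
    rw [hxW _ hc', ← W.inner_eq_inner_starProjection _ hc']
  have hzS' : √(2 - 2 * (1 - z ^ 2 / 2)) ∈ S := by
    rwa [show 2 - 2 * (1 - z ^ 2 / 2) = z ^ 2 by ring, Real.sqrt_sq hz0.le]
  obtain ⟨m, hm⟩ := hf.exists_inner_eq hM (A := {a, a'} ∪ (C : Set M)) (by simp) hx (by
    rintro c ((rfl | rfl) | hc)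
    · rwa [hxa]
    · rwa [hxa']
    · rw [hxC c hc, ← hf.dist_eq]
      exact hf.dist_mem a c fun h => ha (h ▸ hc))
  have hma := (hm a (by simp)).trans hxa
  refine ⟨m, ?_, hma.trans ((hm a' (by simp)).trans hxa').symm, by rw [hma]; linarith⟩
  rintro _ ⟨c, hc, rfl⟩
  exact (hm c (by simp [Finset.mem_coe.1 hc])).trans (hxC c hc)

end OnePoint

/-! ### One-point generation of stabilizers by chaining -/

section Connectedness

variable {S : Set ℝ} {M : Type w} [(metricLanguage S).Structure M]
  {E : Type*} [NormedAddCommGroup E] [InnerProductSpace ℝ E] {f : M → E}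

/-- Move `b` to `b'` by `g` fixing `a` and `C`, then `a` to `a'` by `k` fixing `b'` and `C`;
conjugating `k` by `g` gives an element fixing `b` and `C`. -/
theorem IsSphericalRealization.exists_mem_sup_of_common_point [DecidableEq M]
    (hf : IsSphericalRealization (S := S) f)
    (hM : (metricLanguage S).IsUltrahomogeneous M) {C : Finset M} {a a' b b' : M}
    (ha : a ∉ C) (hb : b ∉ C) (hne : a ≠ b) (haa' : ∀ c ∈ C, ⟪f a', f c⟫_ℝ = ⟪f a, f c⟫_ℝ)
    (hbb' : ∀ c ∈ C, ⟪f b', f c⟫_ℝ = ⟪f b, f c⟫_ℝ) (h : ⟪f b', f a⟫_ℝ = ⟪f b, f a⟫_ℝ)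
    (h' : ⟪f b', f a'⟫_ℝ = ⟪f b, f a⟫_ℝ) :
    ∃ g ∈ fixingSubgroup (M ≃[metricLanguage S] M) ((insert a C : Finset M) : Set M) ⊔
        fixingSubgroup (M ≃[metricLanguage S] M) ((insert b C : Finset M) : Set M),
      g a = a' := by
  have hab' : a ≠ b' := by
    rintro rfl
    rw [hf.inner_self, eq_comm, hf.inner_eq_one_iff] at h
    exact hne h.symm
  obtain ⟨g, hg, hgb⟩ := hf.exists_mem_fixingSubgroup hM (C := insert a C) (a := b) (a' := b')
    (by simp [hne.symm, hb]) (by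
      intro c hc
      rcases Finset.mem_insert.1 hc with rfl | hc
      exacts [h, hbb' c hc])
  obtain ⟨k, hk, hka⟩ := hf.exists_mem_fixingSubgroup hM (C := insert b' C) (a := a) (a' := a')
    (by simp [hab', ha]) (by
      intro c hc
      rcases Finset.mem_insert.1 hc with rfl | hc
      exacts [by rw [real_inner_comm, h', ← h, real_inner_comm], haa' c hc])
  rw [mem_fixingSubgroup_iff] at hk
  have hgC := (mem_fixingSubgroup_iff _).1 hg
  have hconj : g⁻¹ * k * g ∈
      fixingSubgroup (M ≃[metricLanguage S] M) ((insert b C : Finset M) : Set M) := by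
    rw [mem_fixingSubgroup_iff]
    intro c hc
    rw [mul_smul, mul_smul, inv_smul_eq_iff]
    rcases Finset.mem_insert.1 hc with rfl | hc
    · change k • g c = g c
      rw [hgb]
      exact hk b' (by simp)
    · rw [hgC c (by simp [hc])]
      exact hk c (by simp [hc])
  refine ⟨k, ?_, hka⟩
  have hmem := mul_mem (mul_mem (Subgroup.mem_sup_left hg) (Subgroup.mem_sup_right hconj))
    (inv_mem (Subgroup.mem_sup_left hg))
  rwa [show g * (g⁻¹ * k * g) * g⁻¹ = k by group] at hmem

theorem IsSphericalRealization.fixingSubgroup_le_sup_insert [DecidableEq M] [Countable M] (hS : Dense S)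
    (hf : IsSphericalRealization (S := S) f)
    (hM : FirstOrder.Language.IsFraisseLimit (sphericalClass.{w} S) M) (C : Finset M) (a b : M)
    (ha : a ∉ C) (hb : b ∉ C) (hne : a ≠ b) :
    fixingSubgroup (M ≃[metricLanguage S] M) (C : Set M) ≤
      fixingSubgroup (M ≃[metricLanguage S] M) ((insert a C : Finset M) : Set M) ⊔
        fixingSubgroup (M ≃[metricLanguage S] M) ((insert b C : Finset M) : Set M) := by
  set H := fixingSubgroup (M ≃[metricLanguage S] M) ((insert a C : Finset M) : Set M) ⊔
    fixingSubgroup (M ≃[metricLanguage S] M) ((insert b C : Finset M) : Set M) with hH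
  have hHC : H ≤ fixingSubgroup (M ≃[metricLanguage S] M) (C : Set M) :=
    sup_le (fixingSubgroup_antitone _ _ (by simp)) (fixingSubgroup_antitone _ _ (by simp))
  have : FiniteDimensional ℝ (Submodule.span ℝ (f '' C)) :=
    FiniteDimensional.span_of_finite ℝ (C.finite_toSet.image f)
  have hlt := hf.inner_sub_sq_lt ha hb hne
  set ρ := 1 - ‖(Submodule.span ℝ (f '' C)).starProjection (f a)‖ ^ 2 with hρ
  set σ := 1 - ‖(Submodule.span ℝ (f '' C)).starProjection (f b)‖ ^ 2 with hσ
  set t := ⟪f b, f a⟫_ℝ - ⟪(Submodule.span ℝ (f '' C)).starProjection (f b), f a⟫_ℝ with ht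
  -- `σ * ρ - t ^ 2` is positive by `hlt` and bounds how close `a'` must be for a common point; each
  -- midpoint step gains a factor `4 / 3`.
  have key : ∀ (n : ℕ) (a' : M), (∀ c ∈ f '' C, ⟪f a', c⟫_ℝ = ⟪f a, c⟫_ℝ) →
      1 - ⟪f a, f a'⟫_ℝ < (4 / 3) ^ n * (σ * ρ - t ^ 2) → ∃ g ∈ H, g a = a' := by
    intro n
    induction n with
    | zero =>
      intro a' haa' hclose
      rw [pow_zero, one_mul] at hclose
      have hσ1 : σ ≤ 1 := sub_le_self _ (sq_nonneg _)
      have hy : 0 ≤ 1 - ⟪f a, f a'⟫_ℝ := by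
        rw [hf.inner_eq]
        linarith [sq_nonneg (dist (f a) (f a'))]
      -- With `y = 1 - ⟪f a, f a'⟫_ℝ`, the requirement is `2 * t ^ 2 < σ * (2 * ρ - y)`, which
      -- follows from `y < σ * ρ - t ^ 2` and `σ ≤ 1`.
      obtain ⟨b', hb', h₁, h₂⟩ := hf.exists_common_point hM hb hne haa' (by
        rw [← ht, ← hσ]
        have : 1 + ⟪f a, f a'⟫_ℝ - 2 * ‖(Submodule.span ℝ (f '' C)).starProjection (f a)‖ ^ 2 =
          2 * ρ - (1 - ⟪f a, f a'⟫_ℝ) := by rw [hρ]; ring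
        rw [this]
        nlinarith)
      exact hf.exists_mem_sup_of_common_point hM.ultrahomogeneous ha hb hne
        (fun c hc => haa' _ ⟨c, hc, rfl⟩) hb' h₁ h₂
    | succ n ih =>
      intro a' haa' hclose
      rcases eq_or_ne a a' with rfl | haa
      · exact ⟨1, H.one_mem, rfl⟩
      obtain ⟨m, hmC, hma, hlt'⟩ := hf.exists_midpoint hS hM ha haa haa'
      rw [pow_succ] at hclose
      obtain ⟨g, hg, hgm⟩ := ih m hmC (by rw [real_inner_comm]; linarith)
      have hgC := (mem_fixingSubgroup_iff _).1 (hHC (H.inv_mem hg))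
      have hinv : g⁻¹ m = a := by rw [← hgm]; exact g.symm_apply_apply a
      -- Pulling the pair `m`, `a'` back by `g` gives a pair starting at `a`, to which the induction
      -- hypothesis applies again.
      obtain ⟨k, hk, hka⟩ := ih (g⁻¹ a') (by
        rintro _ ⟨c, hc, rfl⟩
        have hc' : g⁻¹ c = c := hgC c hc
        rw [← haa' _ ⟨c, hc, rfl⟩, ← hf.inner_map_map g⁻¹ a' c, hc']) (by
        rw [← hinv, hf.inner_map_map g⁻¹ m a', ← hma]
        linarith)
      refine ⟨g * k, H.mul_mem hg hk, ?_⟩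
      change g (k a) = a'
      rw [hka]
      exact g.apply_symm_apply a'
  intro g hg
  have hgC := (mem_fixingSubgroup_iff _).1 hg
  obtain ⟨n, hn⟩ := pow_unbounded_of_one_lt ((1 - ⟪f a, f (g a)⟫_ℝ) / (σ * ρ - t ^ 2))
    (show (1 : ℝ) < 4 / 3 by norm_num)
  rw [div_lt_iff₀ (by linarith)] at hn
  obtain ⟨h, hh, hha⟩ := key n (g a) (by
    rintro _ ⟨c, hc, rfl⟩
    have hc' : g c = c := hgC c hc
    rw [← hf.inner_map_map g a c, hc']) hn
  have hmem : h⁻¹ * g ∈ H := by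
    refine Subgroup.mem_sup_left ((mem_fixingSubgroup_iff _).2 fun c hc => ?_)
    rw [mul_smul, inv_smul_eq_iff]
    rcases Finset.mem_insert.1 hc with rfl | hc
    · exact hha.symm
    · rw [hgC c hc, (mem_fixingSubgroup_iff _).1 (hHC hh) c hc]
  simpa using H.mul_mem hh hmem

end Connectedness

theorem mainTheorem2 (S : Set ℝ) (hS_countable : S.Countable) (hS_dense : Dense S)
    (M : Type w) [Countable M] [(metricLanguage S).Structure M]
    (hM : FirstOrder.Language.IsFraisseLimit (sphericalClass.{w} S) M) :
    WeaklyEliminatesImaginaries (metricLanguage S) M := by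
  classical
  obtain ⟨E, _, _, f, hf⟩ := exists_isSphericalRealization hM.age.le
  exact weaklyEliminatesImaginaries_of_le_sup (hf.fixingSubgroup_le_sup_insert hS_dense hM)
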